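/- Fix a field $\mathbf k$ and integers $1\le r\le d$. All simplicial complexes are finite and contain the empty face; $f_{i-1}(\Delta)$ is the number of faces of $\Delta$ with $i$ vertices. A $(d-1)$-dimensional simplicial complex $\Delta$ is *balanced* if its vertices can be coloured with $d$ colours so that no face contains two vertices of the same colour. It is a *homology $(d-1)$-sphere* (over $\mathbf k$) if for every face $F\in\Delta$, including $F=\emptyset$, the link of $F$ has the reduced homology $\widetilde H_*(\mathbb S^{d-|F|-1};\mathbf k)$. For $0\le j\le d$ put $h_j(\Delta)=\sum_{i=0}^{j}(-1)^{j-i}\binom{d-i}{d-j}f_{i-1}(\Delta)$, and for $1\le j\le d$ put $\overline g_j(\Delta)=j\,h_j(\Delta)-(d-j+1)\,h_{j-1}(\Delta)$. A *cross-polytopal complex* of dimension $d$ is a finite $d$-dimensional regular CW complex $\mathcal X$ whose $(d-1)$-skeleton is a simplicial complex, in which the boundary of every $d$-cell is a copy of the boundary complex of the $d$-dimensional cross-polytope, and in which no two $d$-cells have the same vertex set. Its *boundary complex* $\partial\mathcal X$ consists of $\emptyset$ and of the faces $F$ with $H_*(\|\mathcal X\|,\|\mathcal X\|-p;\mathbf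 k)=0$ for $p$ in the relative interior of $F$. It is a *homology $d$-ball* if for every $p\in\|\mathcal X\|$ the relative homology $H_*(\|\mathcal X\|,\|\mathcal X\|-p;\mathbf k)$ is either zero or $\mathbf k$ concentrated in degree $d$, if $\widetilde H_*(\|\mathcal X\|;\mathbf k)=0$, and if $\partial\mathcal X$ is a homology $(d-1)$-sphere. A balanced homology $(d-1)$-sphere $\Delta$ has the *balanced $(r-1)$-stacked property* if there is a cross-polytopal complex $\mathcal X$ of dimension $d$ that is a homology $d$-ball with $\partial\mathcal X=\Delta$ and such that every face of $\mathcal X$ of dimension at most $d-r$ is a face of $\Delta$. **Theorem.** Let $\Delta$ be a balanced homology $(d-1)$-sphere with the balanced $(r-1)$-stacked property. Then $\overline g_j(\Delta)=0$ for all $r\le j\le\lfloor d/2\rfloor$. -/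

import Mathlib

/-- A finite (abstract) simplicial complex with vertices in `V`: a finite family of finite sets,
closed under taking subsets. The empty set counts as a face (of dimension `-1`) of every complex
that has a face at all; the vertices are the `v` for which `{v}` is a face. -/
@[ext]
structure FinSimplicialComplex (V : Type*) where
  /-- the faces, including the empty one -/
  faces : Finset (Finset V)
  down_closed : ∀ F ∈ faces, ∀ G, G ⊆ F → G ∈ faces

namespace FinSimplicialComplex

section Basic

variable {V W : Type*} [DecidableEq V] [DecidableEq W]

/-- The complex without any face, not even the empty one. -/
def void (V : Type*) : FinSimplicialComplex V where
  faces := ∅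
  down_closed := by simp

/-- `K.HasFaceSize n` says that `K` has dimension `n - 1`. -/
def HasFaceSize (K : FinSimplicialComplex V) (n : ℕ) : Prop :=
  (∃ F ∈ K.faces, F.card = n) ∧ ∀ F ∈ K.faces, F.card ≤ n

/-- The link of `F` in `K`. -/
def link (K : FinSimplicialComplex V) (F : Finset V) : FinSimplicialComplex V where
  faces := K.faces.filter fun G => Disjoint F G ∧ F ∪ G ∈ K.faces
  down_closed := by
    intro G hG H hH
    simp only [Finset.mem_filter] at hG ⊢
    exact ⟨K.down_closed G hG.1 H hH, hG.2.1.mono_right hH,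
      K.down_closed _ hG.2.2 _ (Finset.union_subset_union_right hH)⟩

/-- The subcomplex of the faces that do not contain `F`. For a nonempty face `F` of `K` and a point
`p` in its relative interior, its realization is a deformation retract of `‖K‖ - p`. -/
def deletion (K : FinSimplicialComplex V) (F : Finset V) : FinSimplicialComplex V where
  faces := K.faces.filter fun G => ¬ F ⊆ G
  down_closed := by
    intro G hG H hH
    simp only [Finset.mem_filter] at hG ⊢
    exact ⟨K.down_closed G hG.1 H hH, fun h => hG.2 (h.trans hH)⟩

/-- The isomorphic copy of `K` along an embedding of vertices. -/
def map (K : FinSimplicialComplex V) (f : V ↪ W) : FinSimplicialComplex W where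
  faces := K.faces.image (Finset.map f)
  down_closed := by
    intro F hF G hG
    obtain ⟨F', hF', rfl⟩ := Finset.mem_image.1 hF
    obtain ⟨G', hG', rfl⟩ := Finset.subset_map_iff.1 hG
    exact Finset.mem_image_of_mem _ (K.down_closed F' hF' G' hG')

/-- The union of two complexes. -/
def union (K L : FinSimplicialComplex V) : FinSimplicialComplex V where
  faces := K.faces ∪ L.faces
  down_closed := by
    intro F hF G hG
    rcases Finset.mem_union.1 hF with h | h
    · exact Finset.mem_union_left _ (K.down_closed F h G hG)
    · exact Finset.mem_union_right _ (L.down_closed F h G hG)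

/-- The union of a finite family of complexes. -/
def iUnion {n : ℕ} (K : Fin n → FinSimplicialComplex V) : FinSimplicialComplex V where
  faces := Finset.univ.biUnion fun i => (K i).faces
  down_closed := by
    intro F hF G hG
    obtain ⟨i, -, hi⟩ := Finset.mem_biUnion.1 hF
    exact Finset.mem_biUnion.2 ⟨i, Finset.mem_univ i, (K i).down_closed F hi G hG⟩

/-- The cone `b * K` over `K` with apex `b` (used when `b` is not a vertex of `K`). -/
def cone (b : V) (K : FinSimplicialComplex V) : FinSimplicialComplex V where
  faces := K.faces ∪ K.faces.image (insert b)
  down_closed := by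
    intro F hF G hG
    have key : ∃ F' ∈ K.faces, F ⊆ insert b F' := by
      rcases Finset.mem_union.1 hF with h | h
      · exact ⟨F, h, Finset.subset_insert b F⟩
      · obtain ⟨F', hF', rfl⟩ := Finset.mem_image.1 h
        exact ⟨F', hF', subset_rfl⟩
    obtain ⟨F', hF', hsub⟩ := key
    have hG' : G.erase b ∈ K.faces :=
      K.down_closed F' hF' _ (by grind)
    by_cases hb : b ∈ G
    · exact Finset.mem_union_right _
        (Finset.mem_image.2 ⟨G.erase b, hG', Finset.insert_erase hb⟩)
    · rw [Finset.erase_eq_of_notMem hb] at hG'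
      exact Finset.mem_union_left _ hG'

/-- The boundary complex of the `d`-dimensional cross-polytope: the vertices `(i, true)` and
`(i, false)` are antipodal, and a set is a face when it contains no antipodal pair. -/
def crossPolytope (d : ℕ) : FinSimplicialComplex (Fin d × Bool) where
  faces := Finset.univ.filter fun F => ∀ i, ¬ ((i, true) ∈ F ∧ (i, false) ∈ F)
  down_closed := by
    intro F hF G hG
    simp only [Finset.mem_filter, Finset.mem_univ, true_and] at hF ⊢
    exact fun i h => hF i ⟨hG h.1, hG h.2⟩

/-- A complex of dimension `d - 1` is balanced if its vertices can be coloured with `d` colours in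
such a way that no face contains two vertices of the same colour. -/
def IsBalanced (K : FinSimplicialComplex V) (d : ℕ) : Prop :=
  K.HasFaceSize d ∧ ∃ κ : V → Fin d, ∀ F ∈ K.faces, Set.InjOn κ (F : Set V)

/-- The number of faces with `i` vertices, that is `f_{i-1}`. -/
def numFaces (K : FinSimplicialComplex V) (i : ℕ) : ℕ :=
  (K.faces.filter fun F => F.card = i).card

/-- The `h`-number `h_j` (for `0 ≤ j ≤ d`) of a complex of dimension `d - 1`. -/
def hNumber (K : FinSimplicialComplex V) (d j : ℕ) : ℤ :=
  ∑ i ∈ Finset.range (j + 1), (-1) ^ (j - i) * ((d - i).choose (d - j) : ℤ) * (K.numFaces i : ℤ)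

/-- The balanced `g`-number `j h_j - (d - j + 1) h_{j-1}` (for `1 ≤ j ≤ d`) of a complex of
dimension `d - 1`. -/
def balancedG (K : FinSimplicialComplex V) (d j : ℕ) : ℤ :=
  (j : ℤ) * K.hNumber d j - ((d : ℤ) - (j : ℤ) + 1) * K.hNumber d (j - 1)

end Basic

noncomputable section Homology

variable (k : Type*) [Field k] {V : Type*} [LinearOrder V]

/-- The simplicial boundary operator: every simplex is oriented by the order on `V`, and the face
opposite to the vertex in position `i` (counting from `0`) gets the sign `(-1) ^ i`. On a vertex it
is the augmentation. -/
def boundaryMap : (Finset V →₀ k) →ₗ[k] (Finset V →₀ k) :=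
  Finsupp.linearCombination k fun F : Finset V =>
    ∑ v ∈ F, Finsupp.single (F.erase v) ((-1 : k) ^ (F.filter fun w => w < v).card)

/-- The (augmented) simplicial chains in degree `n - 1`, spanned by the faces with `n` vertices. -/
def chains (K : FinSimplicialComplex V) (n : ℕ) : Submodule k (Finset V →₀ k) :=
  Finsupp.supported k k {F | F ∈ K.faces ∧ F.card = n}

/-- The relative cycles of `(K, L)` in degree `n - 1`: chains of `K` with boundary in `L`. -/
def relCycles (K L : FinSimplicialComplex V) (n : ℕ) : Submodule k (Finset V →₀ k) :=
  chains k K n ⊓ (Finsupp.supported k k {F | F ∈ L.faces}).comap (boundaryMap k)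

/-- The relative boundaries of `(K, L)` in degree `n - 1`: boundaries in `K` plus chains of `L`. -/
def relBoundaries (K L : FinSimplicialComplex V) (n : ℕ) : Submodule k (Finset V →₀ k) :=
  (chains k K (n + 1)).map (boundaryMap k) ⊔ chains k L n

/-- The dimension of the quotient `Z / B` of a space of cycles by a space of boundaries `B ≤ Z`. -/
def quotientDim {M : Type*} [AddCommGroup M] [Module k M] (Z B : Submodule k M) : ℕ :=
  Module.finrank k (Z ⧸ B.submoduleOf Z)

/-- The dimension of the relative simplicial homology `H_{n-1}(K, L; k)` of a complex `K` and a
subcomplex `L`. -/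
def relBetti (K L : FinSimplicialComplex V) (n : ℕ) : ℕ :=
  quotientDim k (relCycles k K L n) (relBoundaries k K L n)

/-- The reduced Betti number in degree `n - 1`, the dimension of the reduced simplicial homology
`H̃_{n-1}(K; k)`. -/
def reducedBetti (K : FinSimplicialComplex V) (n : ℕ) : ℕ :=
  relBetti k K (void V) n

/-- The dimension of `H_{n-1}(‖K‖, ‖K‖ - p; k)` for a point `p` in the relative interior of the
nonempty face `F`. -/
def localBetti (K : FinSimplicialComplex V) (F : Finset V) (n : ℕ) : ℕ :=
  relBetti k K (K.deletion F) n

/-- The link of `F` has the reduced homology of a sphere of dimension `d - |F| - 1`: it is `k` in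
that degree and zero in all others. -/
def LinkIsSphereLike (K : FinSimplicialComplex V) (d : ℕ) (F : Finset V) : Prop :=
  ∀ n, reducedBetti k (K.link F) n = if n + F.card = d then 1 else 0

/-- `K` is a homology sphere over `k` of dimension `d - 1`. -/
def IsHomologySphere (K : FinSimplicialComplex V) (d : ℕ) : Prop :=
  K.HasFaceSize d ∧ ∀ F ∈ K.faces, LinkIsSphereLike k K d F

/-- `K` is a closed homology manifold over `k` of dimension `d - 1`. -/
def IsClosedHomologyManifold (K : FinSimplicialComplex V) (d : ℕ) : Prop :=
  K.HasFaceSize d ∧ ∀ F ∈ K.faces, F.Nonempty → LinkIsSphereLike k K d F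

/-- The local homology at the interior points of `F` is that at an interior point of a `d`-ball:
`k` in degree `d` and zero in all others. -/
def LocallySphere (K : FinSimplicialComplex V) (d : ℕ) (F : Finset V) : Prop :=
  ∀ n, localBetti k K F n = if n = d + 1 then 1 else 0

/-- The local homology at the interior points of `F` vanishes, as at a boundary point of a ball. -/
def LocallyAcyclic (K : FinSimplicialComplex V) (F : Finset V) : Prop :=
  ∀ n, localBetti k K F n = 0

/-- `B` is the boundary complex of `K`: it consists of the empty face and of the faces at whose
interior points the local homology vanishes. -/
def IsBoundaryComplex (K B : FinSimplicialComplex V) : Prop :=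
  ∀ F, F ∈ B.faces ↔ F = ∅ ∨ (F ∈ K.faces ∧ LocallyAcyclic k K F)

/-- `K` is a homology manifold over `k` of dimension `d` with boundary complex `B`. -/
structure IsHomologyManifoldWithBoundary (K B : FinSimplicialComplex V) (d : ℕ) : Prop where
  dim_eq : K.HasFaceSize (d + 1)
  locally_ball : ∀ F ∈ K.faces, F.Nonempty → LocallyAcyclic k K F ∨ LocallySphere k K d F
  isBoundary : IsBoundaryComplex k K B
  boundary_manifold : IsClosedHomologyManifold k B d

/-- `K` is a homology ball over `k` of dimension `d` with boundary complex `B`. -/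
structure IsHomologyBall (K B : FinSimplicialComplex V) (d : ℕ) : Prop where
  isManifold : IsHomologyManifoldWithBoundary k K B d
  acyclic : ∀ n, reducedBetti k K n = 0
  boundary_sphere : IsHomologySphere k B d

end Homology

end FinSimplicialComplex

/-- A cross-polytopal complex of dimension `d`, given by the combinatorial data that determine it: a
simplicial complex as its `(d-1)`-skeleton, and finitely many `d`-cells (at least one), each attached
to a copy of the boundary of the `d`-dimensional cross-polytope in the skeleton, no two of them with
the same vertex set. -/
structure CrossPolytopalComplex (V : Type*) [DecidableEq V] (d : ℕ) where
  skeleton : FinSimplicialComplex V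
  skeleton_card_le : ∀ F ∈ skeleton.faces, F.card ≤ d
  numCells : ℕ
  numCells_pos : 0 < numCells
  /-- the vertices of the cells; `cell i (j, true)` and `cell i (j, false)` are antipodal -/
  cell : Fin numCells → (Fin d × Bool ↪ V)
  cell_boundary : ∀ i, ((FinSimplicialComplex.crossPolytope d).map (cell i)).faces ⊆ skeleton.faces
  cell_vertices_injective : Function.Injective fun i => Finset.univ.map (cell i)

namespace CrossPolytopalComplex

variable {V : Type*}

/-- The inclusion of the vertices in those of the stellar subdivision. -/
def oldVertex (V : Type*) (m : ℕ) : V ↪ V ⊕ₗ Fin m :=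
  Function.Embedding.inl.trans toLex.toEmbedding

/-- The triangulation of a cross-polytopal complex by stellar subdivision of its `d`-cells: every
`d`-cell is replaced by the cone over its boundary whose apex is a new vertex. It has the same
underlying space. -/
def stellar [LinearOrder V] {d : ℕ} (X : CrossPolytopalComplex V d) :
    FinSimplicialComplex (V ⊕ₗ Fin X.numCells) :=
  (X.skeleton.map (oldVertex V X.numCells)).union
    (FinSimplicialComplex.iUnion fun i =>
      FinSimplicialComplex.cone (toLex (Sum.inr i))
        ((FinSimplicialComplex.crossPolytope d).map ((X.cell i).trans (oldVertex V X.numCells))))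

/-- The cross-polytopal complex `X` is a homology `d`-ball over `k` with boundary complex `Δ`. Local
homology, homology and boundary are those of the triangulation `X.stellar` of its underlying
space. -/
def IsHomologyBall (k : Type*) [Field k] [LinearOrder V] {d : ℕ} (X : CrossPolytopalComplex V d)
    (Δ : FinSimplicialComplex V) : Prop :=
  FinSimplicialComplex.IsHomologyBall k X.stellar (Δ.map (oldVertex V X.numCells)) d

end CrossPolytopalComplex

/-- The balanced `(r-1)`-stacked property, for `1 ≤ r ≤ d`, of a balanced homology sphere `Δ` of
dimension `d - 1`: some cross-polytopal complex `X` is a homology `d`-ball with boundary complex `Δ`,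
and all faces of `X` of dimension at most `d - r` are faces of `Δ`. -/
def FinSimplicialComplex.HasBalancedStackedProperty (k : Type*) [Field k] {V : Type*}
    [LinearOrder V] (Δ : FinSimplicialComplex V) (d r : ℕ) : Prop :=
  ∃ X : CrossPolytopalComplex V d, X.IsHomologyBall k Δ ∧
    ∀ F ∈ X.skeleton.faces, F.card + r ≤ d + 1 → F ∈ Δ.faces

/-!
Triangulate the ball by stellar subdivision of its `m` cells. Its local homology vanishes at the
boundary faces, so by the Euler–Poincaré formula the signed number of faces containing a given
boundary face `F` is zero. The colouring of `Δ` extends to the skeleton, because all edges of the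
skeleton lie in `Δ`. Fix a set `R` of `j` colours with `r - 1 ≤ j ≤ d + 1 - r`. All faces with
colours outside `R` are small enough to be boundary faces, so inclusion–exclusion over them shows
that the signed number of faces of the triangulation that avoid these colours is zero. Among them
are the faces of the skeleton with colours in `R`, and each cell contributes further those that
contain its apex. As a cell meets every colour in exactly one antipodal pair, this contribution does
not depend on the cell, and the flag `h`-number of `R` is `m`. Hence `h_j = m * d.choose j`, the
`h`-number of `m` cross-polytopes, for which `j h_j = (d - j + 1) h_{j-1}`.
-/

namespace FinSimplicialComplex

open Finset

section BoundaryMap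

variable {k : Type*} [Field k] {V : Type*} [LinearOrder V]

theorem boundaryMap_single (F : Finset V) (a : k) :
    boundaryMap k (Finsupp.single F a) =
      a • ∑ v ∈ F, Finsupp.single (F.erase v) ((-1 : k) ^ #{w ∈ F | w < v}) := by
  simp [boundaryMap, Finsupp.linearCombination_single]

theorem neg_one_pow_card_lt_mul_swap {R : Type*} [CommRing R] {F : Finset V} {v w : V}
    (hv : v ∈ F) (hw : w ∈ F) (hvw : v ≠ w) :
    (-1 : R) ^ #{u ∈ F | u < v} * (-1) ^ #{u ∈ F.erase v | u < w} =
      -((-1) ^ #{u ∈ F | u < w} * (-1) ^ #{u ∈ F.erase w | u < v}) := by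
  wlog hlt : v < w generalizing v w
  · rw [this hw hv hvw.symm (lt_of_le_of_ne (not_lt.1 hlt) hvw.symm), neg_neg]
  have erase_larger : {u ∈ F.erase w | u < v} = {u ∈ F | u < v} := by grind
  have erase_smaller : #{u ∈ F | u < w} = #{u ∈ F.erase v | u < w} + 1 := by
    rw [filter_erase, card_erase_add_one (by simp [hv, hlt])]
  rw [erase_larger, erase_smaller]
  ring

theorem boundaryMap_boundaryMap (x : Finset V →₀ k) : boundaryMap k (boundaryMap k x) = 0 := by
  induction x using Finsupp.induction_linear with
  | zero => simp
  | add x y hx hy => simp [hx, hy]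
  | single F a =>
    rw [boundaryMap_single, map_smul, map_sum]
    refine smul_eq_zero_of_right a ?_
    simp_rw [boundaryMap_single, smul_sum, Finsupp.smul_single, smul_eq_mul, sum_sigma']
    -- removing `v` and then `w` cancels against removing `w` and then `v`
    refine sum_involution (fun p _ => ⟨p.2, p.1⟩) ?_ ?_ ?_ fun _ _ => rfl
    · rintro ⟨v, w⟩ h
      obtain ⟨hv, hne, hw⟩ : v ∈ F ∧ w ≠ v ∧ w ∈ F := by simpa using h
      rw [erase_right_comm, ← Finsupp.single_add, neg_one_pow_card_lt_mul_swap hv hw hne.symm,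
        neg_add_cancel, Finsupp.single_zero]
    all_goals grind

theorem boundaryMap_mem_chains {K : FinSimplicialComplex V} {n : ℕ} {x : Finset V →₀ k}
    (hx : x ∈ chains k K (n + 1)) : boundaryMap k x ∈ chains k K n := by
  rw [boundaryMap, Finsupp.linearCombination_apply]
  refine Submodule.sum_mem _ fun F hF => Submodule.smul_mem _ _ <|
    Submodule.sum_mem _ fun v hv => Finsupp.single_mem_supported _ _ ?_
  obtain ⟨hFK, hFn⟩ := (Finsupp.mem_supported _ _).1 hx hF
  exact ⟨K.down_closed F hFK _ (erase_subset _ _), by rw [card_erase_of_mem hv, hFn]; rfl⟩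

theorem boundaryMap_eq_zero_of_mem_chains_zero {K : FinSimplicialComplex V} {x : Finset V →₀ k}
    (hx : x ∈ chains k K 0) : boundaryMap k x = 0 := by
  rw [boundaryMap, Finsupp.linearCombination_apply]
  refine Finset.sum_eq_zero fun F hF => ?_
  have hF₀ : F = ∅ := card_eq_zero.1 ((Finsupp.mem_supported _ _).1 hx hF).2
  simp [hF₀]

end BoundaryMap

theorem numFaces_eq_zero_of_forall_card_lt {V : Type*} {K : FinSimplicialComplex V} {n : ℕ}
    (h : ∀ F ∈ K.faces, #F < n) : K.numFaces n = 0 :=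
  card_eq_zero.2 <| filter_eq_empty_iff.2 fun F hF => (h F hF).ne

theorem sum_faces_card_lt {V : Type*} (K : FinSimplicialComplex V) (φ : ℕ → ℤ) (N : ℕ) :
    ∑ F ∈ K.faces with #F < N, φ #F = ∑ n ∈ range N, φ n * K.numFaces n := by
  rw [← sum_fiberwise_of_maps_to' (t := range N) (g := card) (by simp)]
  refine sum_congr rfl fun n hn => ?_
  rw [sum_const, filter_filter, nsmul_eq_mul, mul_comm, numFaces]
  congr 4
  grind

section EulerPoincare

variable {k : Type*} [Field k] {V : Type*}

theorem chains_mono {K L : FinSimplicialComplex V} (h : L.faces ⊆ K.faces) (n : ℕ) :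
    chains k L n ≤ chains k K n :=
  Finsupp.supported_mono fun _ hF => ⟨h hF.1, hF.2⟩

theorem chains_le_supported (K : FinSimplicialComplex V) (n : ℕ) :
    chains k K n ≤ Finsupp.supported k k {F | F ∈ K.faces} :=
  Finsupp.supported_mono fun _ hF => hF.1

theorem chains_inf_supported {K L : FinSimplicialComplex V} (h : L.faces ⊆ K.faces) (n : ℕ) :
    chains k K n ⊓ Finsupp.supported k k {F | F ∈ L.faces} = chains k L n := by
  rw [chains, chains, ← Finsupp.supported_inter]
  congr 1
  ext F
  exact ⟨fun hF => ⟨hF.2, hF.1.2⟩, fun hF => ⟨⟨h hF.1, hF.2⟩, hF.1⟩⟩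

instance finite_chains (K : FinSimplicialComplex V) (n : ℕ) : Module.Finite k (chains k K n) :=
  have : Finite {F | F ∈ K.faces ∧ #F = n} :=
    (K.faces.finite_toSet.subset fun _ h => h.1).to_subtype
  Module.Finite.equiv (Finsupp.supportedEquivFinsupp (M := k) (R := k) _).symm

theorem finrank_chains (K : FinSimplicialComplex V) (n : ℕ) :
    Module.finrank k (chains k K n) = K.numFaces n := by
  have hset : {F | F ∈ K.faces ∧ #F = n} = ({F ∈ K.faces | #F = n} : Finset (Finset V)) := by
    simp
  rw [chains, hset, (Finsupp.supportedEquivFinsupp (M := k) (R := k) _).finrank_eq,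
    Module.finrank_finsupp_self]
  simp [numFaces]

theorem finrank_map_add_finrank_inf_ker {M N : Type*} [AddCommGroup M] [Module k M]
    [AddCommGroup N] [Module k N] (f : M →ₗ[k] N) (p : Submodule k M) [Module.Finite k p] :
    Module.finrank k (p.map f) + Module.finrank k (p ⊓ LinearMap.ker f : Submodule k M) =
      Module.finrank k p := by
  rw [← LinearMap.finrank_range_add_finrank_ker (f.domRestrict p), LinearMap.range_domRestrict,
    LinearMap.ker_domRestrict, ← Submodule.finrank_map_subtype_eq, Submodule.map_comap_subtype]

variable [LinearOrder V] {K L : FinSimplicialComplex V}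

instance finite_relCycles (n : ℕ) : Module.Finite k (relCycles k K L n) :=
  Submodule.finiteDimensional_of_le (inf_le_left : relCycles k K L n ≤ chains k K n)

theorem relCycles_zero : relCycles k K L 0 = chains k K 0 :=
  inf_eq_left.2 fun x hx => by simp [boundaryMap_eq_zero_of_mem_chains_zero hx]

theorem relBoundaries_le_relCycles (h : L.faces ⊆ K.faces) (n : ℕ) :
    relBoundaries k K L n ≤ relCycles k K L n := by
  refine sup_le ?_ fun x hx => ⟨chains_mono h n hx, ?_⟩
  · rintro _ ⟨x, hx, rfl⟩
    exact ⟨boundaryMap_mem_chains hx, by simp [boundaryMap_boundaryMap]⟩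
  · cases n with
    | zero => simp [boundaryMap_eq_zero_of_mem_chains_zero hx]
    | succ n => exact chains_le_supported L n (boundaryMap_mem_chains hx)

theorem relBetti_add_finrank_relBoundaries (h : L.faces ⊆ K.faces) (n : ℕ) :
    relBetti k K L n + Module.finrank k (relBoundaries k K L n) =
      Module.finrank k (relCycles k K L n) := by
  rw [← (Submodule.submoduleOfEquivOfLe (relBoundaries_le_relCycles h n)).finrank_eq]
  exact Submodule.finrank_quotient_add_finrank _

theorem map_boundaryMap_chains_inf_chains (h : L.faces ⊆ K.faces) (n : ℕ) :
    (chains k K (n + 1)).map (boundaryMap k) ⊓ chains k L n =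
      (relCycles k K L (n + 1)).map (boundaryMap k) := by
  have hle : (chains k K (n + 1)).map (boundaryMap k) ≤ chains k K n :=
    Submodule.map_le_iff_le_comap.2 fun _ hx => boundaryMap_mem_chains hx
  rw [← chains_inf_supported h, ← inf_assoc, inf_eq_left.2 hle, Submodule.map_inf_eq_map_inf_comap,
    relCycles]

theorem finrank_relBoundaries_add_finrank_relCycles (h : L.faces ⊆ K.faces) (n : ℕ) :
    Module.finrank k (relBoundaries k K L n) + Module.finrank k (relCycles k K L (n + 1)) =
      K.numFaces (n + 1) + L.numFaces n := by
  have hker : relCycles k K L (n + 1) ⊓ LinearMap.ker (boundaryMap k) =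
      chains k K (n + 1) ⊓ LinearMap.ker (boundaryMap k) := by
    rw [relCycles, inf_assoc, inf_eq_right.2 (LinearMap.ker_le_comap _)]
  have hchains := finrank_map_add_finrank_inf_ker (boundaryMap k) (chains k K (n + 1))
  have hcycles := finrank_map_add_finrank_inf_ker (boundaryMap k) (relCycles k K L (n + 1))
  have hsup := Submodule.finrank_sup_add_finrank_inf_eq
    ((chains k K (n + 1)).map (boundaryMap k)) (chains k L n)
  rw [finrank_chains] at hchains hsup
  rw [hker] at hcycles
  rw [map_boundaryMap_chains_inf_chains h] at hsup
  rw [relBoundaries]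
  omega

theorem finrank_relCycles_eq_zero {n : ℕ} (hn : ∀ F ∈ K.faces, #F < n) :
    Module.finrank k (relCycles k K L n) = 0 := by
  have hle := Submodule.finrank_mono (inf_le_left : relCycles k K L n ≤ chains k K n)
  rwa [finrank_chains, numFaces_eq_zero_of_forall_card_lt hn, Nat.le_zero] at hle

theorem sum_neg_one_pow_mul_relBetti (h : L.faces ⊆ K.faces) {N : ℕ}
    (hN : ∀ F ∈ K.faces, #F < N) :
    ∑ n ∈ range N, (-1 : ℤ) ^ n * relBetti k K L n =
      ∑ F ∈ K.faces, (-1 : ℤ) ^ #F - ∑ F ∈ L.faces, (-1 : ℤ) ^ #F := by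
  have hsum : ∀ M : FinSimplicialComplex V, M.faces ⊆ K.faces →
      ∑ F ∈ M.faces, (-1 : ℤ) ^ #F = ∑ n ∈ range N, (-1 : ℤ) ^ n * M.numFaces n := by
    intro M hM
    rw [← sum_faces_card_lt, filter_true_of_mem fun F hF => hN F (hM hF)]
  let w : ℕ → ℤ := fun n => Module.finrank k (relCycles k K L n) - K.numFaces n
  have w_zero : w 0 = 0 := sub_eq_zero.2 (by rw [relCycles_zero, finrank_chains])
  have w_N : w N = 0 := by
    simp [w, finrank_relCycles_eq_zero hN, numFaces_eq_zero_of_forall_card_lt hN]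
  have telescope : ∀ n, (-1 : ℤ) ^ n * relBetti k K L n -
      ((-1) ^ n * K.numFaces n - (-1) ^ n * L.numFaces n) =
      (-1) ^ n * w n - (-1) ^ (n + 1) * w (n + 1) := by
    intro n
    have hcycles := relBetti_add_finrank_relBoundaries (k := k) h n
    have hboundaries := finrank_relBoundaries_add_finrank_relCycles (k := k) h n
    zify at hcycles hboundaries
    linear_combination (-1 : ℤ) ^ n * (hcycles - hboundaries)
  rw [hsum K subset_rfl, hsum L h, ← sub_eq_zero, ← sum_sub_distrib, ← sum_sub_distrib,
    sum_congr rfl fun n _ => telescope n, sum_range_sub', w_zero, w_N]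
  simp

end EulerPoincare

section LocalEulerChar

variable {V : Type*}

/-- The Euler characteristic of the pair `(K, K.deletion F)`, with the sign `(-1) ^ n` for a face
with `n` vertices. By the Euler–Poincaré formula it is the alternating sum of the local Betti
numbers of `K` at `F`. -/
def localEulerChar [DecidableEq V] (K : FinSimplicialComplex V) (F : Finset V) : ℤ :=
  ∑ G ∈ K.faces with F ⊆ G, (-1) ^ #G

theorem sum_neg_one_pow_smul_sum_superfaces [DecidableEq V] {A : Type*} [AddCommGroup A]
    (K : FinSimplicialComplex V) (p : V → Prop) [DecidablePred p] (g : Finset V → A) :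
    ∑ F ∈ K.faces with ∀ v ∈ F, p v, (-1 : ℤ) ^ #F • ∑ G ∈ K.faces with F ⊆ G, g G =
      ∑ G ∈ K.faces with ∀ v ∈ G, ¬ p v, g G := by
  have hswap : ∀ F G, (F ∈ {F ∈ K.faces | ∀ v ∈ F, p v} ∧ G ∈ {G ∈ K.faces | F ⊆ G}) ↔
      F ∈ (G.filter p).powerset ∧ G ∈ K.faces := by
    intro F G
    have := K.down_closed G
    simp only [mem_filter, mem_powerset, subset_iff] at *
    grind
  simp_rw [smul_sum]
  rw [sum_comm' hswap, sum_filter]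
  refine sum_congr rfl fun G _ => ?_
  rw [← sum_smul, sum_powerset_neg_one_pow_card, ite_smul, one_smul, zero_smul]
  simp only [filter_eq_empty_iff]

variable {k : Type*} [Field k] [LinearOrder V] {K : FinSimplicialComplex V}

theorem sum_neg_one_pow_mul_localBetti (F : Finset V) {N : ℕ} (hN : ∀ G ∈ K.faces, #G < N) :
    ∑ n ∈ range N, (-1 : ℤ) ^ n * localBetti k K F n = K.localEulerChar F := by
  have hdel : (K.deletion F).faces ⊆ K.faces := filter_subset _ _
  simp only [localBetti, sum_neg_one_pow_mul_relBetti hdel hN]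
  rw [← sum_filter_add_sum_filter_not K.faces (F ⊆ ·), localEulerChar, deletion,
    add_sub_cancel_right]

theorem LocallyAcyclic.localEulerChar_eq_zero {F : Finset V} (h : LocallyAcyclic k K F) :
    K.localEulerChar F = 0 := by
  have hN : ∀ G ∈ K.faces, #G < K.faces.sup card + 1 := fun G hG => Nat.lt_succ_of_le (le_sup hG)
  rw [← sum_neg_one_pow_mul_localBetti (k := k) F hN]
  exact sum_eq_zero fun n _ => by simp [h n]

theorem localBetti_empty (n : ℕ) : localBetti k K ∅ n = reducedBetti k K n := by
  have hdel : K.deletion ∅ = void V := by ext; simp [deletion, void]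
  rw [localBetti, hdel, reducedBetti]

end LocalEulerChar

section Colouring

variable {V C : Type*}

/-- The colouring `κ` of the vertices is proper: no face contains two vertices of the same
colour. -/
def IsProperColouring (K : FinSimplicialComplex V) (κ : V → C) : Prop :=
  ∀ F ∈ K.faces, Set.InjOn κ (F : Set V)

/-- The flag `h`-number of the colour set `R`: up to the sign `(-1) ^ #R`, the reduced Euler
characteristic of the subcomplex induced on the vertices with colours in `R`. -/
def flagHNumber [DecidableEq C] (K : FinSimplicialComplex V) (κ : V → C) (R : Finset C) : ℤ :=
  (-1) ^ #R * ∑ F ∈ K.faces with ∀ v ∈ F, κ v ∈ R, (-1) ^ #F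

theorem IsProperColouring.of_small_faces {K L : FinSimplicialComplex V} {κ : V → C}
    (hκ : L.IsProperColouring κ) (h : ∀ F ∈ K.faces, #F ≤ 2 → F ∈ L.faces) :
    K.IsProperColouring κ := by
  classical
  intro F hF v hv w hw hvw
  have hpair : {v, w} ∈ K.faces :=
    K.down_closed F hF _ (insert_subset hv (singleton_subset_iff.2 hw))
  exact hκ _ (h _ hpair card_le_two) (by simp) (by simp) hvw

theorem IsProperColouring.card_le_card {K : FinSimplicialComplex V} {κ : V → C}
    (hκ : K.IsProperColouring κ) {F : Finset V} (hF : F ∈ K.faces) {R : Finset C}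
    (hR : ∀ v ∈ F, κ v ∈ R) : #F ≤ #R :=
  card_le_card_of_injOn κ hR (hκ F hF)

theorem flagHNumber_congr [DecidableEq C] {K L : FinSimplicialComplex V} {κ : V → C} {R : Finset C}
    (h : ∀ F, (∀ v ∈ F, κ v ∈ R) → (F ∈ K.faces ↔ F ∈ L.faces)) :
    K.flagHNumber κ R = L.flagHNumber κ R := by
  have hfaces : {F ∈ K.faces | ∀ v ∈ F, κ v ∈ R} = {F ∈ L.faces | ∀ v ∈ F, κ v ∈ R} := by
    ext F
    simpa only [mem_filter, and_congr_left_iff] using h F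
  rw [flagHNumber, hfaces, flagHNumber]

theorem hNumber_eq_sum_faces (K : FinSimplicialComplex V) (d j : ℕ) :
    K.hNumber d j =
      ∑ F ∈ K.faces with #F < j + 1, (-1) ^ (j - #F) * ((d - #F).choose (d - j) : ℤ) :=
  (K.sum_faces_card_lt (fun n => (-1) ^ (j - n) * ((d - n).choose (d - j) : ℤ)) (j + 1)).symm

theorem IsProperColouring.card_filter_powersetCard {K : FinSimplicialComplex V} {d j : ℕ}
    (hj : j ≤ d) {κ : V → Fin d} (hκ : K.IsProperColouring κ) {F : Finset V} (hF : F ∈ K.faces) :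
    #{R ∈ powersetCard j univ | ∀ v ∈ F, κ v ∈ R} =
      if #F < j + 1 then (d - #F).choose (d - j) else 0 := by
  have hcolours : #(F.image κ) = #F := card_image_of_injOn (hκ F hF)
  split_ifs with hFj
  · simp_rw [← image_subset_iff]
    rw [card_filter_powersetCard_subset _ _ _ (subset_univ _) (by omega), card_univ,
      Fintype.card_fin, hcolours, ← Nat.choose_symm (by omega)]
    congr 1
    omega
  · refine card_eq_zero.2 (filter_eq_empty_iff.2 fun R hR hFR => hFj ?_)
    rw [← (mem_powersetCard.1 hR).2]
    exact Nat.lt_succ_of_le (hκ.card_le_card hF hFR)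

theorem IsProperColouring.hNumber_eq_sum_flagHNumber {K : FinSimplicialComplex V} {d j : ℕ}
    (hj : j ≤ d) {κ : V → Fin d} (hκ : K.IsProperColouring κ) :
    K.hNumber d j = ∑ R ∈ powersetCard j univ, K.flagHNumber κ R := by
  have hsign : ∀ i ≤ j, (-1 : ℤ) ^ (j - i) = (-1) ^ j * (-1) ^ i := by
    intro i hi
    obtain ⟨c, rfl⟩ := Nat.exists_eq_add_of_le hi
    rw [Nat.add_sub_cancel_left, pow_add, mul_right_comm, ← mul_pow]
    simp
  symm
  calc ∑ R ∈ powersetCard j univ, K.flagHNumber κ R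
      = ∑ R ∈ powersetCard j univ, ∑ F ∈ K.faces with ∀ v ∈ F, κ v ∈ R, (-1) ^ j * (-1) ^ #F :=
        sum_congr rfl fun R hR => by rw [flagHNumber, (mem_powersetCard.1 hR).2, mul_sum]
    _ = ∑ F ∈ K.faces, ∑ R ∈ powersetCard j univ with ∀ v ∈ F, κ v ∈ R, (-1) ^ j * (-1) ^ #F :=
        sum_comm' (by simp only [mem_filter]; tauto)
    _ = ∑ F ∈ K.faces with #F < j + 1, (-1) ^ (j - #F) * ((d - #F).choose (d - j) : ℤ) := by
        rw [sum_filter]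
        refine sum_congr rfl fun F hF => ?_
        rw [sum_const, hκ.card_filter_powersetCard hj hF]
        split_ifs with hFj
        · rw [hsign _ (Nat.le_of_lt_succ hFj), nsmul_eq_mul, mul_comm]
        · rw [zero_nsmul]
    _ = K.hNumber d j := (K.hNumber_eq_sum_faces d j).symm

end Colouring

section CrossPolytope

variable {d : ℕ}

theorem mem_crossPolytope {H : Finset (Fin d × Bool)} :
    H ∈ (crossPolytope d).faces ↔ ∀ i, ¬ ((i, true) ∈ H ∧ (i, false) ∈ H) := by
  simp [crossPolytope]

theorem sum_crossPolytope_faces (R : Finset (Fin d)) :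
    ∑ H ∈ (crossPolytope d).faces with ∀ x ∈ H, x.1 ∈ R, (-1 : ℤ) ^ #H = (-1) ^ #R := by
  calc ∑ H ∈ (crossPolytope d).faces with ∀ x ∈ H, x.1 ∈ R, (-1 : ℤ) ^ #H
      = ∑ P ∈ R.powerset.sigma fun S => (R \ S).powerset, (-1) ^ #P.1 * (-1) ^ #P.2 := by
        refine (sum_bij' (fun P _ => (P.1 ×ˢ {true} ∪ P.2 ×ˢ {false} : Finset (Fin d × Bool)))
          (fun H _ => ⟨univ.filter fun i => (i, true) ∈ H, univ.filter fun i => (i, false) ∈ H⟩)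
          ?_ ?_ ?_ ?_ ?_).symm
        · rintro ⟨S, T⟩ hST
          simp only [mem_sigma, mem_powerset, subset_iff, mem_sdiff] at hST
          simp only [mem_filter, mem_crossPolytope]
          grind
        · intro H hH
          simp only [mem_filter, mem_crossPolytope] at hH
          simp only [mem_sigma, mem_powerset, subset_iff, mem_sdiff, mem_filter, mem_univ, true_and]
          grind
        · rintro ⟨S, T⟩ -
          simp
        · rintro H -
          ext ⟨i, b⟩
          cases b <;> simp
        · rintro ⟨S, T⟩ -
          rw [card_union_of_disjoint (by simp [disjoint_left]), card_product, card_product, pow_add]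
          simp
    _ = ∑ S ∈ R.powerset, (-1) ^ #S * if R \ S = ∅ then 1 else 0 := by
        simp_rw [sum_sigma, ← mul_sum, sum_powerset_neg_one_pow_card]
    _ = (-1) ^ #R := by
        rw [sum_eq_single_of_mem R (mem_powerset_self R)]
        · simp
        · intro S hS hSR
          rw [if_neg fun h => hSR ((mem_powerset.1 hS).antisymm (sdiff_eq_empty_iff_subset.1 h)),
            mul_zero]

theorem IsProperColouring.exists_equiv_of_crossPolytope {κ : Fin d × Bool → Fin d}
    (hκ : (crossPolytope d).IsProperColouring κ) : ∃ e : Fin d ≃ Fin d, ∀ x, κ x = e x.1 := by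
  have hne : ∀ x y : Fin d × Bool, x.1 ≠ y.1 → κ x ≠ κ y := by
    intro x y hxy h
    have hedge : {x, y} ∈ (crossPolytope d).faces := by
      rw [mem_crossPolytope]
      grind
    exact hxy (congrArg Prod.fst (hκ _ hedge (by simp) (by simp) h))
  have hinj : Function.Injective fun i => κ (i, true) := fun i j hij =>
    not_imp_not.1 (hne (i, true) (j, true)) hij
  refine ⟨Equiv.ofBijective _ (Finite.injective_iff_bijective.1 hinj), fun x => ?_⟩
  obtain ⟨i, hi⟩ := Finite.injective_iff_surjective.1 hinj (κ x)
  have hix : i = x.1 := not_imp_not.1 (hne (i, true) x) hi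
  simp [← hi, hix]

theorem IsProperColouring.sum_crossPolytope_faces {κ : Fin d × Bool → Fin d}
    (hκ : (crossPolytope d).IsProperColouring κ) (R : Finset (Fin d)) :
    ∑ H ∈ (crossPolytope d).faces with ∀ x ∈ H, κ x ∈ R, (-1 : ℤ) ^ #H = (-1) ^ #R := by
  obtain ⟨e, he⟩ := hκ.exists_equiv_of_crossPolytope
  simpa [he] using FinSimplicialComplex.sum_crossPolytope_faces (R.map e.symm.toEmbedding)

end CrossPolytope

end FinSimplicialComplex

namespace CrossPolytopalComplex

open Finset FinSimplicialComplex

section Skeleton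

variable {V : Type*} [DecidableEq V] {d : ℕ} (X : CrossPolytopalComplex V d)

theorem map_cell_mem_skeleton (i : Fin X.numCells) {H : Finset (Fin d × Bool)}
    (hH : H ∈ (crossPolytope d).faces) : H.map (X.cell i) ∈ X.skeleton.faces :=
  X.cell_boundary i (mem_image_of_mem _ hH)

theorem empty_mem_skeleton : ∅ ∈ X.skeleton.faces := by
  simpa using X.map_cell_mem_skeleton ⟨0, X.numCells_pos⟩ (H := ∅) (by simp [crossPolytope])

theorem isProperColouring_comp_cell {X : CrossPolytopalComplex V d} {C : Type*} {κ : V → C}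
    (hκ : X.skeleton.IsProperColouring κ) (i : Fin X.numCells) :
    (crossPolytope d).IsProperColouring (κ ∘ X.cell i) := by
  intro H hH x hx y hy hxy
  exact (X.cell i).injective <| hκ _ (X.map_cell_mem_skeleton i hH)
    (mem_coe.2 (mem_map_of_mem _ hx)) (mem_coe.2 (mem_map_of_mem _ hy)) hxy

end Skeleton

section Stellar

theorem inr_notMem_map_oldVertex {V : Type*} {m : ℕ} (i : Fin m) (F : Finset V) :
    toLex (Sum.inr i) ∉ F.map (oldVertex V m) := by
  simp [oldVertex]

variable {V : Type*} [LinearOrder V] {d : ℕ} (X : CrossPolytopalComplex V d)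

/-- The face of the stellar subdivision spanned by the new vertex of the cell `i` and the proper
face `H` of that cell. -/
def coneFace (i : Fin X.numCells) (H : Finset (Fin d × Bool)) : Finset (V ⊕ₗ Fin X.numCells) :=
  insert (toLex (Sum.inr i)) ((H.map (X.cell i)).map (oldVertex V X.numCells))

theorem card_coneFace (i : Fin X.numCells) (H : Finset (Fin d × Bool)) :
    #(X.coneFace i H) = #H + 1 := by
  rw [coneFace, card_insert_of_notMem (inr_notMem_map_oldVertex i _), card_map, card_map]

theorem forall_mem_coneFace {p : V ⊕ₗ Fin X.numCells → Prop} {i : Fin X.numCells}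
    {H : Finset (Fin d × Bool)} : (∀ v ∈ X.coneFace i H, p v) ↔
      p (toLex (Sum.inr i)) ∧ ∀ x ∈ H, p (oldVertex V X.numCells (X.cell i x)) := by
  simp only [coneFace, forall_mem_insert, forall_mem_map]

theorem map_oldVertex_ne_coneFace (F : Finset V) (i : Fin X.numCells)
    (H : Finset (Fin d × Bool)) : F.map (oldVertex V X.numCells) ≠ X.coneFace i H :=
  fun h => inr_notMem_map_oldVertex i F (h ▸ mem_insert_self _ _)

theorem coneFace_injective :
    Function.Injective fun x : Fin X.numCells × Finset (Fin d × Bool) => X.coneFace x.1 x.2 := by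
  rintro ⟨i, H⟩ ⟨i', H'⟩ (h : X.coneFace i H = X.coneFace i' H')
  obtain rfl : i = i' := by
    have hmem : toLex (Sum.inr i) ∈ X.coneFace i' H' := h ▸ mem_insert_self _ _
    simpa using (mem_insert.1 hmem).resolve_right (inr_notMem_map_oldVertex _ _)
  have hbase := congrArg (·.erase (toLex (Sum.inr i))) h
  simpa only [coneFace, erase_insert (inr_notMem_map_oldVertex _ _), map_inj, Prod.mk.injEq,
    true_and] using hbase

theorem stellar_faces : X.stellar.faces =
    X.skeleton.faces.image (Finset.map (oldVertex V X.numCells)) ∪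
      (univ ×ˢ (crossPolytope d).faces).image fun x => X.coneFace x.1 x.2 := by
  ext G
  simp only [stellar, FinSimplicialComplex.union, FinSimplicialComplex.iUnion, cone,
    FinSimplicialComplex.map, mem_union, mem_biUnion, mem_image, mem_univ, true_and, mem_product,
    Prod.exists, coneFace, ← Finset.map_map]
  constructor
  · rintro (hG | ⟨i, ⟨H, hH, rfl⟩ | ⟨_, ⟨H, hH, rfl⟩, rfl⟩⟩)
    · exact Or.inl hG
    · exact Or.inl ⟨_, X.map_cell_mem_skeleton i hH, rfl⟩
    · exact Or.inr ⟨i, H, hH, rfl⟩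
  · rintro (hG | ⟨i, H, hH, rfl⟩)
    · exact Or.inl hG
    · exact Or.inr ⟨i, Or.inr ⟨_, ⟨H, hH, rfl⟩, rfl⟩⟩

theorem mem_stellar {G : Finset (V ⊕ₗ Fin X.numCells)} :
    G ∈ X.stellar.faces ↔ (∃ F ∈ X.skeleton.faces, F.map (oldVertex V X.numCells) = G) ∨
      ∃ i, ∃ H ∈ (crossPolytope d).faces, X.coneFace i H = G := by
  simp [stellar_faces]

theorem map_oldVertex_mem_stellar {F : Finset V} :
    F.map (oldVertex V X.numCells) ∈ X.stellar.faces ↔ F ∈ X.skeleton.faces := by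
  simp [mem_stellar, (X.map_oldVertex_ne_coneFace F _ _).symm]

theorem sum_stellar_faces {A : Type*} [AddCommMonoid A]
    (g : Finset (V ⊕ₗ Fin X.numCells) → A) :
    ∑ G ∈ X.stellar.faces, g G = ∑ F ∈ X.skeleton.faces, g (F.map (oldVertex V X.numCells)) +
      ∑ i, ∑ H ∈ (crossPolytope d).faces, g (X.coneFace i H) := by
  rw [stellar_faces, sum_union, sum_image (Finset.map_injective _).injOn,
    sum_image X.coneFace_injective.injOn, sum_product]
  simp only [disjoint_left, mem_image, not_exists, not_and]
  rintro _ ⟨F, -, rfl⟩ x -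
  exact (X.map_oldVertex_ne_coneFace F x.1 x.2).symm

variable {X}

theorem flagHNumber_skeleton {κ : V → Fin d} (hκ : X.skeleton.IsProperColouring κ)
    {R : Finset (Fin d)} (hR : ∀ F ∈ X.skeleton.faces, (∀ v ∈ F, κ v ∉ R) →
      X.stellar.localEulerChar (F.map (oldVertex V X.numCells)) = 0) :
    X.skeleton.flagHNumber κ R = X.numCells := by
  let p : V ⊕ₗ Fin X.numCells → Prop := fun x => Sum.elim (κ · ∉ R) (fun _ => False) (ofLex x)
  have p_old (v : V) : p (oldVertex V X.numCells v) ↔ κ v ∉ R := Iff.rfl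
  have p_new (i : Fin X.numCells) : ¬ p (toLex (Sum.inr i)) := id
  classical
  have vanish : ∑ G ∈ X.stellar.faces with ∀ v ∈ G, ¬ p v, (-1 : ℤ) ^ #G = 0 := by
    rw [← sum_neg_one_pow_smul_sum_superfaces]
    refine sum_eq_zero fun G hG => smul_eq_zero_of_right _ ?_
    obtain ⟨hG, hGp⟩ := mem_filter.1 hG
    obtain ⟨F, hF, rfl⟩ | ⟨i, H, -, rfl⟩ := X.mem_stellar.1 hG
    · exact hR F hF fun v hv => hGp _ (mem_map_of_mem _ hv)
    · exact absurd (hGp _ (mem_insert_self _ _)) (p_new i)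
  have cone_faces : ∀ i, ∑ H ∈ (crossPolytope d).faces with ∀ x ∈ H, κ (X.cell i x) ∈ R,
      (-1 : ℤ) ^ #(X.coneFace i H) = -(-1) ^ #R := by
    intro i
    have cell := (isProperColouring_comp_cell hκ i).sum_crossPolytope_faces R
    simp only [Function.comp_apply] at cell
    rw [← cell, ← sum_neg_distrib]
    exact sum_congr rfl fun H _ => by rw [card_coneFace, pow_succ, mul_neg_one]
  rw [sum_filter, sum_stellar_faces] at vanish
  simp only [forall_mem_map, p_old, not_not, card_map, ← sum_filter, forall_mem_coneFace, p_new,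
    not_false_eq_true, true_and, cone_faces, sum_const, card_univ, Fintype.card_fin] at vanish
  rw [flagHNumber, eq_neg_of_add_eq_zero_left vanish, smul_neg, neg_neg, nsmul_eq_mul,
    mul_left_comm, ← mul_pow]
  simp

theorem hNumber_eq_numCells_mul_choose {κ : V → Fin d} (hκ : X.skeleton.IsProperColouring κ)
    {Δ : FinSimplicialComplex V} (hΔX : Δ.faces ⊆ X.skeleton.faces)
    (hΔ : ∀ F ∈ Δ.faces, X.stellar.localEulerChar (F.map (oldVertex V X.numCells)) = 0)
    {j : ℕ} (hj : j ≤ d) (hsmall : ∀ F ∈ X.skeleton.faces, #F ≤ max j (d - j) → F ∈ Δ.faces) :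
    Δ.hNumber d j = X.numCells * d.choose j := by
  have hκΔ : Δ.IsProperColouring κ := fun F hF => hκ F (hΔX hF)
  have hflag : ∀ R ∈ powersetCard j univ, Δ.flagHNumber κ R = X.numCells := by
    intro R hR
    have hRj : #R = j := (mem_powersetCard.1 hR).2
    have hRc : #Rᶜ = d - j := by rw [card_compl, Fintype.card_fin, hRj]
    rw [← flagHNumber_skeleton hκ]
    · refine flagHNumber_congr fun F hFR => ⟨fun hF => hΔX hF, fun hF => hsmall F hF ?_⟩
      exact le_max_of_le_left (hRj ▸ hκ.card_le_card hF hFR)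
    · intro F hF hFR
      refine hΔ F (hsmall F hF (le_max_of_le_right (hRc ▸ hκ.card_le_card hF ?_)))
      exact fun v hv => mem_compl.2 (hFR v hv)
  rw [hκΔ.hNumber_eq_sum_flagHNumber hj, sum_congr rfl hflag]
  simp [mul_comm]

section IsHomologyBall

variable {k : Type*} [Field k] {Δ : FinSimplicialComplex V}

theorem IsHomologyBall.boundary_subset_skeleton (hX : X.IsHomologyBall k Δ) :
    Δ.faces ⊆ X.skeleton.faces := by
  intro F hF
  obtain hF₀ | ⟨hFX, -⟩ := (hX.isManifold.isBoundary _).1 (mem_image_of_mem _ hF)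
  · rw [Finset.map_eq_empty.1 hF₀]
    exact X.empty_mem_skeleton
  · exact X.map_oldVertex_mem_stellar.1 hFX

theorem IsHomologyBall.localEulerChar_eq_zero (hX : X.IsHomologyBall k Δ) {F : Finset V}
    (hF : F ∈ Δ.faces) : X.stellar.localEulerChar (F.map (oldVertex V X.numCells)) = 0 := by
  obtain hF₀ | ⟨-, hacyclic⟩ := (hX.isManifold.isBoundary _).1 (mem_image_of_mem _ hF)
  · rw [hF₀]
    exact LocallyAcyclic.localEulerChar_eq_zero (k := k) fun n => by
      rw [localBetti_empty, hX.acyclic]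
  · exact hacyclic.localEulerChar_eq_zero

end IsHomologyBall

end Stellar

end CrossPolytopalComplex

theorem theorem5p4_general {V : Type*} [LinearOrder V] {d r : ℕ} (hr : 1 ≤ r)
    {Δ : FinSimplicialComplex V} {κ : V → Fin d} (hκ : Δ.IsProperColouring κ)
    {X : CrossPolytopalComplex V d} (hΔX : Δ.faces ⊆ X.skeleton.faces)
    (hΔ : ∀ F ∈ Δ.faces,
      X.stellar.localEulerChar (F.map (CrossPolytopalComplex.oldVertex V X.numCells)) = 0)
    (hstacked : ∀ F ∈ X.skeleton.faces, F.card + r ≤ d + 1 → F ∈ Δ.faces) :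
    ∀ j, r ≤ j → j + r ≤ d + 1 → Δ.balancedG d j = 0 := by
  intro j hrj hjr
  obtain ⟨i, rfl⟩ : ∃ i, j = i + 1 := ⟨j - 1, by omega⟩
  have hκX : X.skeleton.IsProperColouring κ := hκ.of_small_faces fun F hF hF₂ =>
    hstacked F hF (by have := X.skeleton_card_le F hF; omega)
  have hNumber_eq : ∀ n, r ≤ n + 1 → n + r ≤ d + 1 → n ≤ d →
      Δ.hNumber d n = X.numCells * d.choose n := fun n _ _ hn =>
    CrossPolytopalComplex.hNumber_eq_numCells_mul_choose hκX hΔX hΔ hn fun F hF hFn =>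
      hstacked F hF (by omega)
  rw [FinSimplicialComplex.balancedG, Nat.add_sub_cancel,
    hNumber_eq (i + 1) (by omega) hjr (by omega), hNumber_eq i hrj (by omega) (by omega)]
  have hchoose := Nat.choose_succ_right_eq d i
  zify [show i ≤ d by omega] at hchoose
  push_cast
  linear_combination (X.numCells : ℤ) * hchoose

theorem theorem5p4 {k : Type*} [Field k] {V : Type*} [LinearOrder V] (d r : ℕ)
    (hr : 1 ≤ r) (hrd : r ≤ d) (Δ : FinSimplicialComplex V)
    (hbal : Δ.IsBalanced d) (hsphere : FinSimplicialComplex.IsHomologySphere k Δ d)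
    (hstacked : FinSimplicialComplex.HasBalancedStackedProperty k Δ d r) :
    ∀ j, r ≤ j → j ≤ d / 2 → Δ.balancedG d j = 0 := by
  obtain ⟨-, κ, hκ⟩ := hbal
  obtain ⟨X, hX, hXΔ⟩ := hstacked
  exact fun j hrj hjd => theorem5p4_general hr hκ hX.boundary_subset_skeleton
    (fun _ => hX.localEulerChar_eq_zero) hXΔ j hrj (by omega)
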